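/- Let $r\ge 1$, $n\ge 1$ be integers, write $\mathbb{Z}_m=\mathbb{Z}/m\mathbb{Z}$, and let $\lambda:\mathbb{Z}_n\to\mathbb{C}^\times$ be an additive character. Let $d$ be the positive divisor of $n$ such that $\lambda$ has order $n/d$ (equivalently, if $\lambda(x)=\exp(2\pi i a x/n)$, then $d=\gcd(a,n)$); then $\lambda$ factors through the reduction map $\mathbb{Z}_n\to\mathbb{Z}_{n/d}$, and the resulting character of $\mathbb{Z}_{n/d}$ is again denoted by $\lambda$. Put $$G(\mathrm{SL}_r(\mathbb{Z}_n),\lambda)=\sum_{X\in \mathrm{SL}_r(\mathbb{Z}_n)}\lambda(\operatorname{tr}X),\qquad K_r(\mathbb{Z}_{n/d},\lambda)=\sum_{\substack{x_1,\dots,x_r\in\mathbb{Z}_{n/d}\\ x_1x_2\cdots x_r=1}}\lambda(x_1+x_2+\cdots+x_r).$$ Then $$G(\mathrm{SL}_r(\mathbb{Z}_n),\lambda)=n^{r(r-1)/2}\,d^{\,r(r+1)/2-1}\prod_{\substack{p\mid n\\ p\nmid n/d}}\ \prod_{i=2}^r\left(1-p^{-i}\right)\cdot K_r(\mathbb{Z}_{n/d},\lambda),$$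 where the outer product runs over the primes $p$ dividing $n$ but not $n/d$. -/

import Mathlib

/-- The Gauss sum of the special linear group `SL_r(ℤ/nℤ)` at an additive character `ψ`. -/
noncomputable def gaussSumSL (r n : ℕ) [NeZero n] (ψ : AddChar (ZMod n) ℂ) : ℂ :=
  ∑ X : Matrix.SpecialLinearGroup (Fin r) (ZMod n), ψ (Matrix.trace X.1)

/-- The hyper-Kloosterman sum over `ℤ/mℤ` at an additive character `ψ`. -/
noncomputable def hyperKloosterman (r m : ℕ) [NeZero m] (ψ : AddChar (ZMod m) ℂ) : ℂ :=
  ∑ x : Fin r → ZMod m with ∏ i, x i = 1, ψ (∑ i, x i)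

/-- An additive character `ψ` of `ℤ/nℤ` of order `m`, viewed as a character of `ℤ/mℤ`:
the additive character of `ℤ/mℤ` that sends `1` to `ψ 1`. See `inducedChar_castHom`. -/
noncomputable def inducedChar {n m : ℕ} [NeZero m] (ψ : AddChar (ZMod n) ℂ)
    (h : orderOf ψ = m) : AddChar (ZMod m) ℂ :=
  AddChar.zmodChar m (ζ := ψ 1) (by
    rw [← AddChar.pow_apply, ← h, pow_orderOf_eq_one, AddChar.one_apply])

/-- `ψ` is the pullback of `inducedChar ψ h` along the reduction `ℤ/nℤ → ℤ/mℤ`. -/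
theorem inducedChar_castHom {n m : ℕ} [NeZero n] [NeZero m] (ψ : AddChar (ZMod n) ℂ)
    (h : orderOf ψ = m) (hmn : m ∣ n) (x : ZMod n) :
    inducedChar ψ h (ZMod.castHom hmn (ZMod m) x) = ψ x := by
  obtain ⟨k, rfl⟩ := ZMod.natCast_zmod_surjective x
  rw [map_natCast, inducedChar, AddChar.zmodChar_apply', ← AddChar.map_nsmul_eq_pow,
    nsmul_one]

/-- Summing a function along a surjective homomorphism of finite groups. -/
@[to_additive /-- Summing a function along a surjective homomorphism of finite additive groups. -/]
theorem MonoidHom.card_nsmul_sum_comp {A B K : Type*} [Group A] [Group B] [Fintype A] [Fintype B]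
    [AddCommMonoid K] (f : A →* B) (hf : Function.Surjective f) (g : B → K) :
    Fintype.card B • (∑ a, g (f a)) = Fintype.card A • ∑ b, g b := by
  classical
  have key (b : B) : Finset.card {a | f a = b} = Finset.card {a | f a = 1} :=
    MonoidHom.card_fiber_eq_of_mem_range f (hf b) (hf 1)
  have hsum : ∑ a, g (f a) = Finset.card {a | f a = 1} • ∑ b, g b := by
    rw [← Finset.sum_fiberwise (s := Finset.univ) (g := f), ← Finset.sum_nsmul]
    refine Finset.sum_congr rfl fun b _ ↦ ?_
    rw [← key b]
    exact Finset.sum_eq_card_nsmul fun a ha ↦ by rw [(Finset.mem_filter.1 ha).2]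
  have hcard : Fintype.card A = Fintype.card B * Finset.card {a | f a = 1} := by
    rw [← Finset.card_univ, Finset.card_eq_sum_card_fiberwise (f := f) (t := Finset.univ)
      (fun _ _ ↦ by simp)]
    simp [key]
  rw [hsum, hcard, mul_nsmul']

theorem Fintype.card_units_eq_sum {A : Type*} [Monoid A] [Fintype A] [Fintype Aˣ]
    [DecidablePred (IsUnit : A → Prop)] :
    Fintype.card Aˣ = ∑ a : A, if IsUnit a then 1 else 0 := by
  rw [Finset.sum_boole, Nat.cast_id, ← Finset.card_univ,
    ← Finset.card_map ⟨_, Units.val_injective⟩]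
  congr 1
  ext a
  simp only [Finset.mem_map, Finset.mem_univ, true_and, Function.Embedding.coeFn_mk,
    Finset.mem_filter]
  rfl

/-- A surjective local homomorphism of finite rings multiplies the number of units by the size
of its kernel. -/
theorem RingHom.card_units_mul_card {A B : Type*} [Ring A] [Ring B] [Fintype A] [Fintype B]
    [Fintype Aˣ] [Fintype Bˣ] (f : A →+* B) (hf : Function.Surjective f) [IsLocalHom f] :
    Fintype.card Aˣ * Fintype.card B = Fintype.card A * Fintype.card Bˣ := by
  classical
  have h := f.toAddMonoidHom.card_nsmul_sum_comp hf (fun b ↦ if IsUnit b then (1 : ℕ) else 0)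
  simp only [RingHom.toAddMonoidHom_eq_coe, AddMonoidHom.coe_coe, isUnit_map_iff,
    smul_eq_mul] at h
  rwa [← Fintype.card_units_eq_sum, ← Fintype.card_units_eq_sum, mul_comm] at h

theorem Matrix.card_eq_pow_mul {ι : Type*} [Fintype ι] [DecidableEq ι] [Nonempty ι] (T : Type*)
    [Fintype T] : Fintype.card (Matrix ι ι T) =
      Fintype.card T ^ (Fintype.card ι ^ 2 - 1) * Fintype.card T := by
  rw [← pow_succ, Nat.sub_add_cancel (Nat.one_le_pow _ _ Fintype.card_pos), sq, pow_mul]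
  exact Fintype.card_fun.trans (by rw [Fintype.card_fun])

namespace Matrix.SpecialLinearGroup

variable {ι : Type*} [Fintype ι] [DecidableEq ι] {R S : Type*} [CommRing R] [CommRing S]

theorem card_mul_card_units [Nonempty ι] [Fintype R] [Fintype Rˣ] [Fintype (GL ι R)]
    [Fintype (SpecialLinearGroup ι R)] :
    Fintype.card (SpecialLinearGroup ι R) * Fintype.card Rˣ = Fintype.card (GL ι R) := by
  classical
  have h := (GeneralLinearGroup.det : GL ι R →* Rˣ).card_nsmul_sum_comp
    GeneralLinearGroup.det_surjective (fun u ↦ if u = 1 then (1 : ℕ) else 0)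
  rw [Finset.sum_boole, Fintype.sum_ite_eq', smul_eq_mul, smul_eq_mul, mul_one, Nat.cast_id,
    mul_comm] at h
  rw [← h]
  congr 1
  rw [← Finset.card_univ, ← Finset.card_map ⟨_, toGL_injective⟩]
  congr 1
  ext g
  simp only [Finset.mem_map, Finset.mem_univ, true_and, Function.Embedding.coeFn_mk,
    Finset.mem_filter]
  constructor
  · rintro ⟨X, rfl⟩
    ext
    simp
  · intro hg
    refine ⟨⟨g, ?_⟩, by ext; rfl⟩
    simpa using congrArg Units.val hg

theorem isLocalHom_mapMatrix (f : R →+* S) [IsLocalHom f] :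
    IsLocalHom (f.mapMatrix : Matrix ι ι R →+* Matrix ι ι S) where
  map_nonunit X hX := by
    rw [isUnit_iff_isUnit_det, ← RingHom.map_det] at hX
    exact (isUnit_iff_isUnit_det X).2 (isUnit_of_map_unit f _ hX)

theorem map_surjective [Nonempty ι] (f : R →+* S) (hf : Function.Surjective f) [IsLocalHom f] :
    Function.Surjective (map f : SpecialLinearGroup ι R →* SpecialLinearGroup ι S) := by
  intro Y
  obtain ⟨X, hX⟩ : ∃ X : Matrix ι ι R, f.mapMatrix X = Y.1 := by
    choose g hg using hf
    exact ⟨Y.1.map g, by ext; simp [hg]⟩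
  have hdet : f X.det = 1 := by rw [RingHom.map_det, hX, Y.2]
  obtain ⟨u, hu⟩ := isUnit_of_map_unit f X.det (hdet ▸ isUnit_one)
  have hfu : f (u⁻¹ : Rˣ) = 1 := by
    have : f (u⁻¹ : Rˣ) * f u = 1 := by rw [← map_mul]; simp
    rwa [hu, hdet, mul_one] at this
  let i : ι := Classical.arbitrary ι
  refine ⟨⟨diagonal (Function.update 1 i (u⁻¹ : Rˣ).1) * X, ?_⟩, ?_⟩
  · rw [det_mul, det_diagonal, Finset.prod_update_of_mem (Finset.mem_univ i), ← hu]
    simp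
  · apply Subtype.ext
    change f.mapMatrix _ = Y.1
    rw [map_mul, hX]
    convert one_mul Y.1
    ext a b
    by_cases hab : a = b
    · subst hab
      by_cases ha : a = i
      · subst ha; simp [hfu]
      · simp [ha]
    · simp [hab]

/-- Along a surjective local homomorphism of finite rings, `#SL(R) / #R ^ (r ^ 2 - 1)` is
constant. -/
theorem card_mul_card_pow [Nonempty ι] [Fintype R] [Fintype S]
    [Fintype (SpecialLinearGroup ι R)] [Fintype (SpecialLinearGroup ι S)]
    (f : R →+* S) (hf : Function.Surjective f) [IsLocalHom f] :
    Fintype.card (SpecialLinearGroup ι R) * Fintype.card S ^ (Fintype.card ι ^ 2 - 1) =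
      Fintype.card R ^ (Fintype.card ι ^ 2 - 1) * Fintype.card (SpecialLinearGroup ι S) := by
  classical
  have : IsLocalHom (f.mapMatrix : Matrix ι ι R →+* Matrix ι ι S) := isLocalHom_mapMatrix f
  have hf' : Function.Surjective (f.mapMatrix : Matrix ι ι R →+* Matrix ι ι S) := by
    intro Y
    choose g hg using hf
    exact ⟨Y.map g, by ext; simp [hg]⟩
  have h1 := f.card_units_mul_card hf
  have h2 := RingHom.card_units_mul_card (f.mapMatrix : Matrix ι ι R →+* Matrix ι ι S) hf'
  have h3 := card_mul_card_units (ι := ι) (R := R)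
  have h4 := card_mul_card_units (ι := ι) (R := S)
  change Fintype.card (GL ι R) * _ = _ * Fintype.card (GL ι S) at h2
  rw [← h3, ← h4, card_eq_pow_mul R, card_eq_pow_mul S] at h2
  have hpos : 0 < Fintype.card Rˣ * Fintype.card S := Nat.mul_pos Fintype.card_pos Fintype.card_pos
  refine Nat.eq_of_mul_eq_mul_right hpos ?_
  calc _ = Fintype.card (SpecialLinearGroup ι R) * Fintype.card Rˣ *
        (Fintype.card S ^ (Fintype.card ι ^ 2 - 1) * Fintype.card S) := by ring
    _ = Fintype.card R ^ (Fintype.card ι ^ 2 - 1) * Fintype.card (SpecialLinearGroup ι S) *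
        (Fintype.card R * Fintype.card Sˣ) := by rw [h2]; ring
    _ = _ := by rw [h1]

/-- A ring isomorphism induces a bijection of special linear groups. -/
def congrEquiv (f : R ≃+* S) : SpecialLinearGroup ι R ≃ SpecialLinearGroup ι S where
  toFun := map f.toRingHom
  invFun := map f.symm.toRingHom
  left_inv X := by ext; simp
  right_inv X := by ext; simp

/-- The special linear group over a product of rings. -/
def prodEquiv : SpecialLinearGroup ι (R × S) ≃ SpecialLinearGroup ι R × SpecialLinearGroup ι S where
  toFun X := (map (RingHom.fst R S) X, map (RingHom.snd R S) X)
  invFun Y := ⟨of fun i j ↦ (Y.1 i j, Y.2 i j), by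
    refine Prod.ext ?_ ?_
    · refine (RingHom.map_det (RingHom.fst R S) _).trans (Eq.trans ?_ Y.1.2)
      congr 1
    · refine (RingHom.map_det (RingHom.snd R S) _).trans (Eq.trans ?_ Y.2.2)
      congr 1⟩
  left_inv X := by ext <;> rfl
  right_inv Y := by
    refine Prod.ext ?_ ?_ <;> ext <;> rfl

end Matrix.SpecialLinearGroup

namespace Matrix

variable {r : ℕ} {R : Type*} [CommRing R]

/-- The upper triangular matrix with diagonal `x` and entries `u` above the diagonal. -/
def ofUpper (x : Fin r → R) (u : {q : Fin r × Fin r // q.1 < q.2} → R) : Matrix (Fin r) (Fin r) R :=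
  of fun i j ↦ if h : i < j then u ⟨(i, j), h⟩ else if i = j then x i else 0

theorem ofUpper_blockTriangular (x : Fin r → R) (u : {q : Fin r × Fin r // q.1 < q.2} → R) :
    (ofUpper x u).BlockTriangular id := by
  intro i j (hij : j < i)
  simp [ofUpper, hij.not_gt, hij.ne']

theorem ofUpper_diag (x : Fin r → R) (u : {q : Fin r × Fin r // q.1 < q.2} → R) (i : Fin r) :
    ofUpper x u i i = x i := by
  simp [ofUpper]

theorem trace_mul_ofUpper_one (X : Matrix (Fin r) (Fin r) R) (u : Fin r × Fin r → R) :
    (X * ofUpper 1 (fun q ↦ u q)).trace =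
      X.trace + ∑ q : Fin r × Fin r, if q.1 < q.2 then u q * X q.2 q.1 else 0 := by
  rw [Fintype.sum_prod_type_right, trace, trace, ← Finset.sum_add_distrib]
  refine Finset.sum_congr rfl fun i _ ↦ ?_
  rw [diag_apply, mul_apply]
  have : X.diag i = ∑ j, if j = i then X i j else 0 := by simp
  rw [this, ← Finset.sum_add_distrib]
  refine Finset.sum_congr rfl fun j _ ↦ ?_
  by_cases h1 : j < i
  · simp [ofUpper, h1, h1.ne, mul_comm]
  · by_cases h2 : j = i
    · simp [ofUpper, h2]
    · simp [ofUpper, h1, h2]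

open Classical in
/-- Averaging over upper unitriangular matrices leaves only the upper triangular matrices. -/
theorem sum_specialLinearGroup_eq_sum_upper [Fintype R] [DecidableEq R] (ψ : AddChar R ℂ)
    (hψ : ψ.IsPrimitive) :
    ∑ X : SpecialLinearGroup (Fin r) R, ψ X.1.trace =
      ∑ X : SpecialLinearGroup (Fin r) R with ∀ i j, j < i → X.1 i j = 0, ψ X.1.trace := by
  have hcard : (Fintype.card R : ℂ) ≠ 0 := Nat.cast_ne_zero.2 Fintype.card_ne_zero
  have hinv (u : Fin r × Fin r → R) : ∑ X : SpecialLinearGroup (Fin r) R, ψ X.1.trace =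
      ∑ X : SpecialLinearGroup (Fin r) R, ψ X.1.trace *
        ∏ q : Fin r × Fin r, ψ (if q.1 < q.2 then u q * X.1 q.2 q.1 else 0) := by
    have hdet : (ofUpper 1 (fun q ↦ u q) : Matrix (Fin r) (Fin r) R).det = 1 := by
      rw [det_of_isUpperTriangular (ofUpper_blockTriangular _ _)]
      simp [ofUpper_diag]
    let V : SpecialLinearGroup (Fin r) R := ⟨_, hdet⟩
    have hV : V.1 = ofUpper 1 (fun q ↦ u q) := rfl
    rw [← Equiv.sum_comp (Equiv.mulRight V)]
    refine Finset.sum_congr rfl fun X _ ↦ ?_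
    rw [Equiv.coe_mulRight, SpecialLinearGroup.coe_mul, hV, trace_mul_ofUpper_one,
      AddChar.map_add_eq_mul]
    exact congrArg _ (map_prod ψ.toMonoidHom _ Finset.univ)
  have hsum (X : SpecialLinearGroup (Fin r) R) :
      ∑ u : Fin r × Fin r → R,
        ∏ q : Fin r × Fin r, ψ (if q.1 < q.2 then u q * X.1 q.2 q.1 else 0) =
      (Fintype.card R : ℂ) ^ Fintype.card (Fin r × Fin r) *
        if ∀ i j, j < i → X.1 i j = 0 then 1 else 0 := by
    rw [← Fintype.prod_sum (fun (q : Fin r × Fin r) (t : R) ↦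
      ψ (if q.1 < q.2 then t * X.1 q.2 q.1 else 0))]
    have hq (q : Fin r × Fin r) : ∑ t : R, ψ (if q.1 < q.2 then t * X.1 q.2 q.1 else 0) =
        Fintype.card R * if q.1 < q.2 → X.1 q.2 q.1 = 0 then 1 else 0 := by
      by_cases h : q.1 < q.2
      · simp only [h, if_true, forall_const, AddChar.sum_mulShift _ hψ]
        split_ifs <;> simp
      · simp [h]
    simp_rw [hq, Finset.prod_mul_distrib, Finset.prod_const, Finset.card_univ]
    congr 1
    rw [Fintype.prod_boole]
    refine if_congr ?_ rfl rfl
    exact ⟨fun h i j ↦ h (j, i), fun h q ↦ h q.2 q.1⟩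
  refine mul_left_cancel₀ (pow_ne_zero (Fintype.card (Fin r × Fin r)) hcard) ?_
  calc _ = ∑ u : Fin r × Fin r → R, ∑ X : SpecialLinearGroup (Fin r) R, ψ X.1.trace := by
        simp
    _ = _ := by
        rw [Finset.sum_congr rfl fun u _ ↦ hinv u, Finset.sum_comm]
        simp_rw [← Finset.mul_sum, hsum]
        rw [Finset.sum_filter, Finset.mul_sum]
        refine Finset.sum_congr rfl fun X _ ↦ ?_
        split_ifs <;> ring

open Classical in
theorem sum_upper_specialLinearGroup [Fintype R] [DecidableEq R] (ψ : AddChar R ℂ) :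
    ∑ X : SpecialLinearGroup (Fin r) R with ∀ i j, j < i → X.1 i j = 0, ψ X.1.trace =
      (Fintype.card R : ℂ) ^ Fintype.card {q : Fin r × Fin r // q.1 < q.2} *
        ∑ x : Fin r → R with ∏ i, x i = 1, ψ (∑ i, x i) := by
  have hdet (x : Fin r → R) (hx : ∏ i, x i = 1) (u) : (ofUpper x u).det = 1 := by
    rw [det_of_isUpperTriangular (ofUpper_blockTriangular _ _)]
    simpa [ofUpper_diag] using hx
  calc _ = ∑ y ∈ ({x : Fin r → R | ∏ i, x i = 1} : Finset _) ×ˢ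
        (Finset.univ : Finset ({q : Fin r × Fin r // q.1 < q.2} → R)), ψ (∑ i, y.1 i) := by
        refine Finset.sum_bij' (fun X _ ↦ (X.1.diag, fun q ↦ X.1 q.1.1 q.1.2))
          (fun y hy ↦ ⟨ofUpper y.1 y.2, hdet y.1 (by simpa using hy) y.2⟩) ?_ ?_ ?_ ?_ ?_
        · intro X hX
          have hX : X.1.BlockTriangular id := (Finset.mem_filter.1 hX).2
          simpa using (det_of_isUpperTriangular hX).symm.trans X.2
        · intro y hy
          exact Finset.mem_filter.2
            ⟨Finset.mem_univ _, fun i j hij ↦ ofUpper_blockTriangular y.1 y.2 hij⟩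
        · intro X hX
          have hX := (Finset.mem_filter.1 hX).2
          apply Subtype.ext
          ext i j
          rcases lt_trichotomy i j with h | h | h
          · simp [ofUpper, h]
          · simp [ofUpper, h]
          · simpa [ofUpper, h.not_gt, h.ne'] using (hX i j h).symm
        · intro y hy
          refine Prod.ext (funext fun i ↦ ofUpper_diag _ _ i) (funext fun q ↦ ?_)
          simp [ofUpper, q.2]
        · intro X hX
          rfl
    _ = _ := by
        rw [Finset.sum_product, Finset.mul_sum]
        simp

end Matrix

theorem Fin.card_pairs_lt (r : ℕ) :
    Fintype.card {q : Fin r × Fin r // q.1 < q.2} = r * (r - 1) / 2 := by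
  rw [Fintype.card_subtype, Finset.card_filter, Fintype.sum_prod_type_right]
  simp only [← Finset.card_filter, Finset.filter_gt_eq_Iio, Fin.card_Iio]
  rw [Fin.sum_univ_eq_sum_range (fun i ↦ i), Finset.sum_range_id]

theorem inducedChar_isPrimitive {n m : ℕ} [NeZero n] [NeZero m] (ψ : AddChar (ZMod n) ℂ)
    (h : orderOf ψ = m) : (inducedChar ψ h).IsPrimitive := by
  have hroot : IsPrimitiveRoot (ψ 1) m := by
    rw [IsPrimitiveRoot.iff_def]
    refine ⟨by rw [← AddChar.pow_apply, ← h, pow_orderOf_eq_one, AddChar.one_apply], fun l hl ↦ ?_⟩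
    rw [← h]
    refine orderOf_dvd_of_pow_eq_one (DFunLike.ext _ _ fun x ↦ ?_)
    obtain ⟨k, rfl⟩ := ZMod.natCast_zmod_surjective x
    rw [← nsmul_one, AddChar.map_nsmul_eq_pow, AddChar.pow_apply, hl, AddChar.map_nsmul_eq_pow]
    simp
  exact AddChar.zmodChar_primitive_of_primitive_root m hroot

theorem gaussSumSL_of_isPrimitive (r m : ℕ) [NeZero m] (ψ : AddChar (ZMod m) ℂ)
    (hψ : ψ.IsPrimitive) :
    gaussSumSL r m ψ = (m : ℂ) ^ (r * (r - 1) / 2) * hyperKloosterman r m ψ := by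
  rw [gaussSumSL, Matrix.sum_specialLinearGroup_eq_sum_upper ψ hψ,
    Matrix.sum_upper_specialLinearGroup, Fin.card_pairs_lt, ZMod.card, hyperKloosterman]

theorem card_specialLinearGroup_zmod_prime (r p : ℕ) (hr : 1 ≤ r) [Fact p.Prime] :
    (Fintype.card (Matrix.SpecialLinearGroup (Fin r) (ZMod p)) : ℂ) =
      (p : ℂ) ^ (r ^ 2 - 1) * ∏ i ∈ Finset.Icc 2 r, (1 - (p : ℂ) ^ (-(i : ℤ))) := by
  have : Nonempty (Fin r) := ⟨⟨0, hr⟩⟩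
  have hp : (p : ℂ) ≠ 0 := Nat.cast_ne_zero.2 (Fact.out : p.Prime).ne_zero
  have hp1 : (p : ℂ) - 1 ≠ 0 := sub_ne_zero.2 (by exact_mod_cast (Fact.out : p.Prime).ne_one)
  have h := Matrix.SpecialLinearGroup.card_mul_card_units (ι := Fin r) (R := ZMod p)
  rw [← Nat.card_eq_fintype_card (α := GL _ _), Matrix.card_GL_field, ZMod.card_units_eq_totient,
    Nat.totient_prime Fact.out, ZMod.card] at h
  have hC := congrArg (Nat.cast : ℕ → ℂ) h
  rw [Nat.cast_mul, Nat.cast_sub (Fact.out : p.Prime).one_le, Nat.cast_one, Nat.cast_prod] at hC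
  refine mul_right_cancel₀ hp1 (hC.trans ?_)
  have hterm (i : Fin r) : ((p ^ r - p ^ (i : ℕ) : ℕ) : ℂ) =
      p ^ r * (1 - (p : ℂ) ^ (-((r - i : ℕ) : ℤ))) := by
    rw [Nat.cast_sub (Nat.pow_le_pow_right (Fact.out : p.Prime).pos i.2.le), Nat.cast_pow,
      Nat.cast_pow, zpow_neg, zpow_natCast, mul_sub, mul_one, pow_sub₀ _ hp i.2.le]
    field_simp
  rw [Finset.prod_congr rfl fun i _ ↦ hterm i, Finset.prod_mul_distrib, Finset.prod_const,
    Finset.card_univ, Fintype.card_fin, ← pow_mul, ← sq,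
    Fin.prod_univ_eq_prod_range (fun i ↦ 1 - (p : ℂ) ^ (-((r - i : ℕ) : ℤ)))]
  have hIcc : ∏ i ∈ Finset.range r, (1 - (p : ℂ) ^ (-((r - i : ℕ) : ℤ))) =
      ∏ i ∈ Finset.Icc 1 r, (1 - (p : ℂ) ^ (-(i : ℤ))) := by
    refine Finset.prod_bij' (fun i _ ↦ r - i) (fun i _ ↦ r - i) ?_ ?_ ?_ ?_ ?_ <;>
      intro i hi <;> simp only [Finset.mem_range, Finset.mem_Icc] at hi ⊢ <;> omega
  rw [hIcc, ← Finset.mul_prod_Ioc_eq_prod_Icc hr,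
    show Finset.Ioc 1 r = Finset.Icc 2 r from rfl]
  obtain ⟨k, hk⟩ : ∃ k, r ^ 2 = k + 1 := ⟨r ^ 2 - 1, by have := Nat.one_le_pow 2 r hr; omega⟩
  rw [hk, Nat.add_sub_cancel, pow_succ, Nat.cast_one, zpow_neg_one]
  field_simp

theorem trace_map_specialLinearGroup {ι R S : Type*} [Fintype ι] [DecidableEq ι] [CommRing R]
    [CommRing S] (f : R →+* S) (X : Matrix.SpecialLinearGroup ι R) :
    (Matrix.SpecialLinearGroup.map f X).1.trace = f X.1.trace :=
  (AddMonoidHom.map_trace f.toAddMonoidHom X.1).symm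

theorem ZMod.isLocalHom_castHom_mul {p n : ℕ} [NeZero (p * n)] (hp : p ∣ n) (h : n ∣ p * n) :
    IsLocalHom (ZMod.castHom h (ZMod n)) where
  map_nonunit x hx := by
    obtain ⟨k, rfl⟩ := ZMod.natCast_zmod_surjective x
    rw [map_natCast, ZMod.isUnit_iff_coprime] at hx
    rw [ZMod.isUnit_iff_coprime]
    exact (hx.coprime_dvd_right hp).mul_right hx

/-- Pulling a character back from `ℤ/n` to `ℤ/pn` when `p ∣ n`. -/
theorem gaussSumSL_comp_castHom_of_dvd (r p n : ℕ) (hr : 1 ≤ r) [NeZero n] [NeZero (p * n)]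
    (hp : p ∣ n) (h : n ∣ p * n) (ψ : AddChar (ZMod n) ℂ) :
    gaussSumSL r (p * n) (ψ.compAddMonoidHom (ZMod.castHom h (ZMod n)).toAddMonoidHom) =
      (p : ℂ) ^ (r ^ 2 - 1) * gaussSumSL r n ψ := by
  have : Nonempty (Fin r) := ⟨⟨0, hr⟩⟩
  have := ZMod.isLocalHom_castHom_mul hp h
  have hs := ZMod.castHom_surjective h
  have hcard := Matrix.SpecialLinearGroup.card_mul_card_pow (ι := Fin r) _ hs
  have hsum := (Matrix.SpecialLinearGroup.map (n := Fin r)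
    (ZMod.castHom h (ZMod n))).card_nsmul_sum_comp
    (Matrix.SpecialLinearGroup.map_surjective _ hs) (fun Y ↦ ψ Y.1.trace)
  simp only [trace_map_specialLinearGroup, nsmul_eq_mul] at hsum
  change _ * gaussSumSL r (p * n) (ψ.compAddMonoidHom
    (ZMod.castHom h (ZMod n)).toAddMonoidHom) = _ * gaussSumSL r n ψ at hsum
  rw [ZMod.card, ZMod.card, Fintype.card_fin] at hcard
  have hcard' := congrArg (Nat.cast : ℕ → ℂ) hcard
  push_cast at hcard'
  have hn : (n : ℂ) ^ (r ^ 2 - 1) ≠ 0 := pow_ne_zero _ (NeZero.ne _)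
  have hS : (Fintype.card (Matrix.SpecialLinearGroup (Fin r) (ZMod n)) : ℂ) ≠ 0 :=
    Nat.cast_ne_zero.2 Fintype.card_ne_zero
  refine mul_left_cancel₀ (mul_ne_zero hn hS) ?_
  rw [mul_assoc, hsum, ← mul_assoc, mul_comm ((n : ℂ) ^ _), hcard', mul_pow]
  ring

/-- Pulling a character back from `ℤ/n` to `ℤ/pn` when `p` and `n` are coprime. -/
theorem gaussSumSL_comp_castHom_of_coprime (r p n : ℕ) [NeZero p] [NeZero n] [NeZero (p * n)]
    (hp : p.Coprime n) (h : n ∣ p * n) (ψ : AddChar (ZMod n) ℂ) :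
    gaussSumSL r (p * n) (ψ.compAddMonoidHom (ZMod.castHom h (ZMod n)).toAddMonoidHom) =
      Fintype.card (Matrix.SpecialLinearGroup (Fin r) (ZMod p)) * gaussSumSL r n ψ := by
  let f := ZMod.chineseRemainder hp
  let e : Matrix.SpecialLinearGroup (Fin r) (ZMod (p * n)) ≃
      Matrix.SpecialLinearGroup (Fin r) (ZMod p) × Matrix.SpecialLinearGroup (Fin r) (ZMod n) :=
    (Matrix.SpecialLinearGroup.congrEquiv f).trans Matrix.SpecialLinearGroup.prodEquiv
  have hf : ZMod.castHom h (ZMod n) = (RingHom.snd _ _).comp f.toRingHom := RingHom.ext_zmod _ _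
  have he (X) : ψ.compAddMonoidHom (ZMod.castHom h (ZMod n)).toAddMonoidHom X.1.trace =
      ψ (e X).2.1.trace := by
    rw [hf]
    exact congrArg ψ (trace_map_specialLinearGroup ((RingHom.snd _ _).comp f.toRingHom) X).symm
  rw [gaussSumSL, Finset.sum_congr rfl fun X _ ↦ he X,
    e.sum_comp (fun Y ↦ ψ Y.2.1.trace), Fintype.sum_prod_type]
  simp [gaussSumSL]

theorem gaussSumSL_comp_castHom (r m d n : ℕ) (hr : 1 ≤ r) [NeZero m] [NeZero n]
    (hn : n = d * m) (h : m ∣ n) (ψ : AddChar (ZMod m) ℂ) :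
    gaussSumSL r n (ψ.compAddMonoidHom (ZMod.castHom h (ZMod m)).toAddMonoidHom) =
      (d : ℂ) ^ (r ^ 2 - 1) * (∏ p ∈ n.primeFactors with ¬ p ∣ m,
          ∏ i ∈ Finset.Icc 2 r, (1 - (p : ℂ) ^ (-(i : ℤ)))) * gaussSumSL r m ψ := by
  induction d using induction_on_primes generalizing n with
  | zero => exact absurd (hn.trans (zero_mul m)) (NeZero.ne n)
  | one =>
    obtain rfl : n = m := hn.trans (one_mul m)
    rw [Finset.filter_false_of_mem fun p hp ↦ not_not.2 (Nat.dvd_of_mem_primeFactors hp)]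
    have : ψ.compAddMonoidHom (ZMod.castHom h (ZMod n)).toAddMonoidHom = ψ := by
      ext x
      rw [Subsingleton.elim (ZMod.castHom h (ZMod n)) (RingHom.id _)]
      rfl
    rw [this]
    simp
  | prime_mul p d hp ih =>
    have : Fact p.Prime := ⟨hp⟩
    rw [mul_assoc] at hn
    have hdm : d * m ≠ 0 := fun h0 ↦ NeZero.ne n (by rw [hn, h0, mul_zero])
    have : NeZero (d * m) := ⟨hdm⟩
    subst hn
    have h1 : d * m ∣ p * (d * m) := Dvd.intro_left p rfl
    have h2 : m ∣ d * m := Dvd.intro_left d rfl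
    have hcomp : ψ.compAddMonoidHom (ZMod.castHom h (ZMod m)).toAddMonoidHom =
        (ψ.compAddMonoidHom (ZMod.castHom h2 (ZMod m)).toAddMonoidHom).compAddMonoidHom
          (ZMod.castHom h1 (ZMod (d * m))).toAddMonoidHom := by
      rw [RingHom.ext_zmod (ZMod.castHom h (ZMod m))
        ((ZMod.castHom h2 (ZMod m)).comp (ZMod.castHom h1 (ZMod (d * m))))]
      rfl
    rw [hcomp]
    by_cases hpd : p ∣ d * m
    · rw [gaussSumSL_comp_castHom_of_dvd r p _ hr hpd h1, ih (d * m) rfl h2,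
        Nat.primeFactors_mul hp.ne_zero hdm, hp.primeFactors, Finset.union_eq_right.2
          (Finset.singleton_subset_iff.2 (Nat.mem_primeFactors.2 ⟨hp, hpd, hdm⟩))]
      push_cast
      ring
    · rw [gaussSumSL_comp_castHom_of_coprime r p _ ((Nat.Prime.coprime_iff_not_dvd hp).2 hpd) h1,
        ih (d * m) rfl h2, card_specialLinearGroup_zmod_prime r p hr,
        Nat.primeFactors_mul hp.ne_zero hdm, hp.primeFactors, Finset.singleton_union,
        Finset.filter_insert, if_pos fun hm ↦ hpd (hm.trans h2), Finset.prod_insert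
          fun hmem ↦ hpd (Nat.dvd_of_mem_primeFactors (Finset.mem_filter.1 hmem).1)]
      push_cast
      ring

/-- `NeZero (n / d)` is automatic from `d ∣ n` and `n ≠ 0`; it only supplies the finiteness
instance for `ZMod (n / d)`. -/
theorem theorem5 (r n d : ℕ) [NeZero n] [NeZero (n / d)] (hr : 1 ≤ r) (hd : d ∣ n)
    (ψ : AddChar (ZMod n) ℂ) (hψ : orderOf ψ = n / d) :
    gaussSumSL r n ψ =
      (n : ℂ) ^ (r * (r - 1) / 2) * (d : ℂ) ^ (r * (r + 1) / 2 - 1) *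
        (∏ p ∈ n.primeFactors with ¬ p ∣ n / d,
          ∏ i ∈ Finset.Icc 2 r, (1 - (p : ℂ) ^ (-(i : ℤ)))) *
        hyperKloosterman r (n / d) (inducedChar ψ hψ) := by
  have hn : n = d * (n / d) := (Nat.mul_div_cancel' hd).symm
  have hmn : n / d ∣ n := Nat.div_dvd_of_dvd hd
  have hlift : ψ = (inducedChar ψ hψ).compAddMonoidHom
      (ZMod.castHom hmn (ZMod (n / d))).toAddMonoidHom :=
    DFunLike.ext _ _ fun x ↦ (inducedChar_castHom ψ hψ hmn x).symm
  have hexp : r ^ 2 - 1 = r * (r - 1) / 2 + (r * (r + 1) / 2 - 1) := by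
    obtain ⟨k, rfl⟩ := Nat.exists_eq_add_of_le' hr
    obtain ⟨a, ha⟩ := Nat.even_mul_succ_self k
    have h1 : (k + 1) * (k + 1 - 1) = 2 * a := by rw [Nat.add_sub_cancel]; linarith
    have h2 : (k + 1) * (k + 1 + 1) = 2 * (a + k + 1) := by linarith
    have h3 : (k + 1) ^ 2 = 2 * a + k + 1 := by linarith
    rw [h1, h2, h3]
    omega
  have hnC : (n : ℂ) = d * (n / d : ℕ) := by exact_mod_cast hn
  calc gaussSumSL r n ψ = _ := congrArg (gaussSumSL r n) hlift
    _ = _ := gaussSumSL_comp_castHom r (n / d) d n hr hn hmn _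
    _ = _ := by
      rw [gaussSumSL_of_isPrimitive r (n / d) _ (inducedChar_isPrimitive ψ hψ), hexp, hnC, mul_pow,
        pow_add]
      ring
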